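/- **Conventions.** For $x,y\in 2^{\mathbb N}$ write $x\le_T y$ if $x$ is Turing reducible to $y$, and $x\equiv_T y$ if $x\le_T y$ and $y\le_T x$; the cone above $b$ is $\{x : x\ge_T b\}$, and a property holds for all $x$ on a cone if it holds for every $x$ in the cone above some $b$. For $A\subseteq 2^{\mathbb N}$, in the Gale–Stewart game $\mathcal G_A$ two players alternately choose the bits $x(0),x(1),x(2),\dots$ of some $x\in 2^{\mathbb N}$ (player I the even ones), and player I wins iff $x\in A$; $A$ is determined if one of the players has a winning strategy. *Analytic determinacy* says that every (boldface) analytic $A\subseteq 2^{\mathbb N}$ is determined. A hypothesis class is a set $\mathcal H\subseteq\{0,1\}^{\mathbb N}$. For a probability distribution $\mathcal D$ on $\mathbb N\times\{0,1\}$ put $L_{\mathcal D}(h)=\Pr_{(a,y)\sim\mathcal D}[h(a)\ne y]$. Let $\mathcal S$ be the set of finite sequences of elements of $\mathbb N\times\{0,1\}$. A learner $A:\mathcal S\to\{0,1\}^{\mathbb N}$ and a sample size function $m:(0,1)^2\to\mathbb N$ satisfy the PAC guarantee for $\mathcal H$ if for every $\mathcal D$, all $\varepsilon,\delta\in(0,1)$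 and every $n\ge m(\varepsilon,\delta)$, $$\Pr_{S\sim\mathcal D^n}\Big[L_{\mathcal D}(A(S))\le\inf_{h\in\mathcal H}L_{\mathcal D}(h)+\varepsilon\Big]\ge 1-\delta .$$ $\mathcal H$ is PAC learnable if some $A$ with all values in $\mathcal H$ and some $m$ satisfy the PAC guarantee for $\mathcal H$. $\mathcal H$ is improperly SCPAC learnable relative to $x$ if it is PAC learnable and some $x$-computable learner $A$, whose values need not lie in $\mathcal H$, together with some $x$-computable sample size function $m$, satisfies the PAC guarantee for $\mathcal H$. Here $A$ is $x$-computable if $(S,a)\mapsto A(S)(a)$ is (equivalently, an $x$-program for $A(S)$ can be $x$-computed from $S$), and $m$ is $x$-computable if its values at rational arguments, given as fractions, can be $x$-computed. **Corollary 4.7.** Assume analytic determinacy. Let $x\mapsto\mathcal H_x$ assign to each $x\in 2^{\mathbb N}$ a hypothesis class. Suppose that the family is degree-invariant ($x\equiv_T y$ implies $\mathcal H_x=\mathcal H_y$) and Borel (its graph $\{(x,f) : f\in\mathcal H_x\}$ is a Borel subset of $2^{\mathbb N}\times 2^{\mathbb N}$), and that $\mathcal H_x$ is PAC learnable for all $x$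 on a cone. Then, for all $x$ on a cone, $\mathcal H_x$ is improperly SCPAC learnable relative to $x$. -/

import Mathlib

open MeasureTheory

namespace ConeLearning

/-! ### Gale–Stewart games on Cantor space and analytic determinacy -/

/-- The play `x` follows the strategy `σ` of player I, who moves at the even positions: every even
bit of `x` is the one that `σ` prescribes after the finite sequence of bits played so far. -/
def FollowsI (σ : List Bool → Bool) (x : ℕ → Bool) : Prop :=
  ∀ n : ℕ, x (2 * n) = σ (List.ofFn fun i : Fin (2 * n) => x i)

/-- The play `x` follows the strategy `τ` of player II, who moves at the odd positions. -/
def FollowsII (τ : List Bool → Bool) (x : ℕ → Bool) : Prop :=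
  ∀ n : ℕ, x (2 * n + 1) = τ (List.ofFn fun i : Fin (2 * n + 1) => x i)

/-- The game with payoff set `A` (player I wins the play `x` iff `x ∈ A`) is determined: one of the
two players has a winning strategy. -/
def Determined (A : Set (ℕ → Bool)) : Prop :=
  (∃ σ : List Bool → Bool, ∀ x, FollowsI σ x → x ∈ A) ∨
    (∃ τ : List Bool → Bool, ∀ x, FollowsII τ x → x ∉ A)

/-- Every (boldface) analytic subset of Cantor space is determined. -/
def AnalyticDeterminacy : Prop :=
  ∀ A : Set (ℕ → Bool), AnalyticSet A → Determined A

/-! ### Turing reducibility on Cantor space -/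

/-- An infinite binary string as a (total) function on the natural numbers with values `0`, `1`. -/
def oracle (x : ℕ → Bool) : ℕ →. ℕ := fun n => Part.some (x n).toNat

/-- `x ≤_T y`. -/
def TuringLE (x y : ℕ → Bool) : Prop := TuringReducible (oracle x) (oracle y)

/-- `x ≡_T y`. -/
def TuringEquiv (x y : ℕ → Bool) : Prop := TuringLE x y ∧ TuringLE y x

/-- The cone above `b`. -/
def cone (b : ℕ → Bool) : Set (ℕ → Bool) := {x | TuringLE b x}

/-! ### PAC learning; domain `ℕ`, labels `Bool` -/

/-- A sample is a finite sequence of labelled points. -/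
abbrev Sample : Type := List (ℕ × Bool)

/-- The true error `Pr_{(a, y) ∼ D} [h a ≠ y]` of the hypothesis `h`. -/
noncomputable def trueError (D : Measure (ℕ × Bool)) (h : ℕ → Bool) : ℝ :=
  D.real {p | h p.1 ≠ p.2}

/-- The learner `A` (whose hypotheses may lie outside `H`) and the sample size function `m` satisfy
the agnostic PAC guarantee for `H`: for every distribution `D` and all `ε, δ ∈ (0, 1)`, on an
i.i.d. sample of any size `n ≥ m ε δ`, with probability at least `1 - δ` the true error of the
output is at most `inf_{h ∈ H} L_D(h) + ε`. -/
def PACGuarantee (H : Set (ℕ → Bool)) (A : Sample → (ℕ → Bool)) (m : ℝ → ℝ → ℕ) : Prop :=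
  ∀ D : Measure (ℕ × Bool), IsProbabilityMeasure D →
    ∀ ε ∈ Set.Ioo (0 : ℝ) 1, ∀ δ ∈ Set.Ioo (0 : ℝ) 1, ∀ n : ℕ, m ε δ ≤ n →
      1 - δ ≤ (Measure.pi fun _ : Fin n => D).real
        {S : Fin n → ℕ × Bool |
          trueError D (A (List.ofFn S)) ≤ sInf (trueError D '' H) + ε}

/-- (Proper) PAC learnability: the learner outputs hypotheses in `H`. In particular `H ≠ ∅`. -/
def PACLearnable (H : Set (ℕ → Bool)) : Prop :=
  ∃ (A : Sample → (ℕ → Bool)) (m : ℝ → ℝ → ℕ), (∀ S, A S ∈ H) ∧ PACGuarantee H A m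

/-- The learner `A` is `x`-computable: from a sample `S` one obtains, uniformly and computably in
the oracle `x`, an algorithm for the hypothesis `A S`. By the s-m-n theorem this says that the
two-variable function `(S, a) ↦ A S a` is `x`-computable. -/
def ComputableLearner (x : ℕ → Bool) (A : Sample → (ℕ → Bool)) : Prop :=
  ComputableIn₂ {oracle x} A

/-- The sample size function `m` is `x`-computable: its value at rational arguments, presented as
fractions `i / j` and `k / l` of natural numbers, is computed with the oracle `x`. -/
def ComputableSampleSize (x : ℕ → Bool) (m : ℝ → ℝ → ℕ) : Prop :=
  ComputableIn₂ {oracle x} fun p q : ℕ × ℕ => m ((p.1 : ℝ) / p.2) ((q.1 : ℝ) / q.2)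

/-- `H` is improperly SCPAC learnable relative to the oracle `x`: it is PAC learnable and some
`x`-computable learner, with outputs not necessarily in `H`, satisfies the PAC guarantee for `H`
with an `x`-computable sample size function. -/
def ImproperlySCPAC (x : ℕ → Bool) (H : Set (ℕ → Bool)) : Prop :=
  PACLearnable H ∧ ∃ (A : Sample → (ℕ → Bool)) (m : ℝ → ℝ → ℕ),
    ComputableLearner x A ∧ ComputableSampleSize x m ∧ PACGuarantee H A m

/-! ### Families of hypothesis classes -/

/-- The family `x ↦ H x` is degree-invariant. -/
def DegreeInvariant (H : (ℕ → Bool) → Set (ℕ → Bool)) : Prop :=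
  ∀ x y, TuringEquiv x y → H x = H y

/-- The family `x ↦ H x` is Borel: its graph is a Borel subset of `2^ℕ × 2^ℕ`. -/
def BorelFamily (H : (ℕ → Bool) → Set (ℕ → Bool)) : Prop :=
  MeasurableSet[borel ((ℕ → Bool) × (ℕ → Bool))] {p | p.2 ∈ H p.1}

end ConeLearning

/-! For a fixed finite string `s`, the set of `x` such that some member of `H x` extends `s` is
analytic, being a projection of a Borel set, and degree-invariant. Martin's cone theorem
(`exists_cone_subset_or_compl`) makes membership in it constant on a cone. There are only countably
many `s`, so on one cone `H x` has the same finite traces for all `x`. A distribution on `ℕ × Bool`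
has vanishing tails, so the optimal error over a class, and with it the PAC guarantee, depends only
on these traces (`PACGuarantee.of_realizes_iff`). Hence a learner for a single `H z` serves every `H
x` on the cone. It is a countable object, so an oracle codes it; its values lie in `H z`, perhaps
not in `H x`, which is why learning is improper. -/

namespace ConeLearning

/-! ### Computability relative to an oracle -/

section Computability

variable {α β γ σ : Type*} [Primcodable α] [Primcodable β] [Primcodable γ] [Primcodable σ]
  {O : Set (ℕ →. ℕ)}

open Encodable

theorem computableIn_iff {f : α → σ} : ComputableIn O f ↔
    Nat.RecursiveIn O fun n => Part.bind (decode (α := α) n) fun a => Part.some (encode (f a)) := by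
  simp [ComputableIn, RecursiveIn]

theorem computableIn_comp {g : β → σ} {f : α → β} (hg : ComputableIn O g)
    (hf : ComputableIn O f) : ComputableIn O fun a => g (f a) := by
  rw [computableIn_iff] at *
  refine (hg.comp hf).of_eq fun n => ?_
  cases decode (α := α) n <;> simp [encodek]

theorem computableIn_pair {f : α → β} {g : α → γ} (hf : ComputableIn O f)
    (hg : ComputableIn O g) : ComputableIn O fun a => (f a, g a) := by
  rw [computableIn_iff] at *
  refine (hf.pair hg).of_eq fun n => ?_
  cases decode (α := α) n <;> simp [Seq.seq]

theorem computableIn_natRec (c : σ) {h : ℕ × σ → σ} (hh : ComputableIn O h) :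
    ComputableIn O fun n : ℕ => (Nat.rec c (fun k s => h (k, s)) n : σ) := by
  have hc : Nat.RecursiveIn O fun _ => Part.some (encode c) :=
    (Nat.Primrec.const (encode c)).recursiveIn
  have hid : Nat.RecursiveIn O fun n => Part.some n := Nat.Primrec.id.recursiveIn
  rw [computableIn_iff] at *
  refine ((Nat.RecursiveIn.prec hc (hh.comp .right)).comp (.pair hid hid)).of_eq fun n => ?_
  have key : ∀ m : ℕ, (Nat.rec (Part.some (encode c)) (fun y IH => IH.bind fun i =>
      (Part.some (Nat.unpair (Nat.pair n (Nat.pair y i))).2).bind fun k =>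
        Part.bind (decode (α := ℕ × σ) k) fun a => Part.some (encode (h a))) m : Part ℕ) =
      Part.some (encode (Nat.rec c (fun k s => h (k, s)) m : σ)) := by
    intro m
    induction m with
    | zero => rfl
    | succ m ih => simp only [ih]; simp [encodek]
  simpa [Seq.seq] using key n

/-- Unbounded search over candidate values finds `f a`. Oracles consist of bits, so a number-valued
function is coded through its graph. -/
theorem computableIn_of_graph {f : α → ℕ}
    (hf : ComputableIn O fun p : α × ℕ => decide (f p.1 = p.2)) : ComputableIn O f := by
  -- `rfind` looks for a zero, so success is coded by `0`.
  have hg : ComputableIn O fun p : α × ℕ => if f p.1 = p.2 then 0 else 1 :=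
    (computableIn_comp (g := fun b : Bool => cond b 0 1)
      (Primrec.cond Primrec.id (Primrec.const 0) (Primrec.const 1)).computableIn hf).of_eq
        fun p => by by_cases h : f p.1 = p.2 <;> simp [h]
  rw [computableIn_iff] at hg ⊢
  have hr := hg.rfind
  have hdom := computableIn_iff.1 (ComputableIn.id (α := α) (O := O))
  refine (hr.comp hdom).of_eq fun n => ?_
  cases decode (α := α) n with
  | none => simp
  | some a =>
    simp only [Part.coe_some, Part.bind_some, Part.bind_eq_bind]
    refine Part.eq_some_iff.2 (Nat.mem_rfind.2 ⟨?_, ?_⟩)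
    · simp [encodek]
    · intro m hm
      have : f a ≠ m := by simpa using hm.ne'
      simp [encodek, this]

theorem oracle_computableIn (x : ℕ → Bool) : ComputableIn {oracle x} x := by
  rw [computableIn_iff]
  refine (Nat.RecursiveIn.oracle (oracle x) (Set.mem_singleton _)).of_eq fun n => ?_
  cases h : x n <;> simp [oracle, h]

theorem turingLE_iff {x y : ℕ → Bool} : TuringLE x y ↔ ComputableIn {oracle y} x := by
  rw [TuringLE, TuringReducible, RecursiveIn.iff_nat, computableIn_iff]
  have : ∀ n, oracle x n = Part.bind (decode (α := ℕ) n) fun a => Part.some (encode (x a)) := by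
    intro n
    cases h : x n <;> simp [oracle, h]
  exact ⟨fun h => h.of_eq this, fun h => h.of_eq fun n => (this n).symm⟩

theorem ComputableIn.of_turingLE {x y : ℕ → Bool} {f : α → σ} (hf : ComputableIn {oracle x} f)
    (h : TuringLE x y) : ComputableIn {oracle y} f :=
  hf.subst fun _ hg => Set.mem_singleton_iff.1 hg ▸ h

theorem TuringLE.trans {x y z : ℕ → Bool} (hxy : TuringLE x y) (hyz : TuringLE y z) :
    TuringLE x z :=
  TuringReducible.trans hxy hyz

theorem exists_computableIn_oracle (f : α → Bool) :
    ∃ b : ℕ → Bool, ComputableIn {oracle b} f := by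
  refine ⟨fun n => ((decode (α := α) n).map f).getD false, ?_⟩
  exact (computableIn_comp (oracle_computableIn _) Primrec.encode.computableIn).of_eq
    fun a => by simp [encodek]

theorem exists_computableIn_oracle_nat (f : α → ℕ) :
    ∃ b : ℕ → Bool, ComputableIn {oracle b} f :=
  (exists_computableIn_oracle fun p : α × ℕ => decide (f p.1 = p.2)).imp
    fun _ => computableIn_of_graph

theorem exists_turingLE_forall {ι : Type*} [Countable ι] (b : ι → ℕ → Bool) :
    ∃ c : ℕ → Bool, ∀ i, TuringLE (b i) c := by
  obtain ⟨e, he⟩ := exists_injective_nat ι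
  obtain ⟨c, hc⟩ := exists_computableIn_oracle
    (fun p : ℕ × ℕ => Function.extend e b (fun _ _ => false) p.1 p.2)
  refine ⟨c, fun i => turingLE_iff.2 ?_⟩
  exact (computableIn_comp hc (computableIn_pair (ComputableIn.const (e i)) ComputableIn.id)).of_eq
    fun n => by simp [he.extend_apply]

end Computability

/-! ### Games and Martin's cone theorem -/

section Games

/-- The position after `n` moves if every bit is chosen by `g` from the position before it. -/
def position (g : List Bool → Bool) (n : ℕ) : List Bool :=
  Nat.rec [] (fun _ l => l ++ [g l]) n

/-- The play in which every bit is chosen by `g` from the position before it. -/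
def play (g : List Bool → Bool) (n : ℕ) : Bool := g (position g n)

theorem position_eq_ofFn (g : List Bool → Bool) (n : ℕ) :
    position g n = List.ofFn fun i : Fin n => play g i := by
  induction n with
  | zero => rfl
  | succ n ih =>
    rw [List.ofFn_succ_last]
    simp only [Fin.val_castSucc, Fin.val_last, ← ih]
    rfl

theorem length_position (g : List Bool → Bool) (n : ℕ) : (position g n).length = n := by
  simp [position_eq_ofFn]

theorem computableIn_play {O : Set (ℕ →. ℕ)} {g : List Bool → Bool} (hg : ComputableIn O g) :
    ComputableIn O (play g) := by
  have hstep : ComputableIn O fun p : ℕ × List Bool => p.2 ++ [g p.2] :=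
    computableIn_comp (g := fun q : List Bool × Bool => q.1 ++ [q.2])
      (Primrec.list_concat.computableIn)
      (computableIn_pair ComputableIn.snd (computableIn_comp hg ComputableIn.snd))
  exact computableIn_comp (f := position g) hg (computableIn_natRec [] hstep)

/-- Follow `s` at the positions whose length has parity `r`, and play the bits of `x` elsewhere. -/
def against (r : Bool) (s : List Bool → Bool) (x : ℕ → Bool) (l : List Bool) : Bool :=
  cond (l.length.bodd == r) (s l) (x l.length.div2)

theorem computableIn_against {O : Set (ℕ →. ℕ)} (r : Bool) {s : List Bool → Bool}
    {x : ℕ → Bool} (hs : ComputableIn O s) (hx : ComputableIn O x) :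
    ComputableIn O (against r s x) := by
  have hlen : ComputableIn O fun l : List Bool => l.length := Primrec.list_length.computableIn
  have hc : ComputableIn O fun l : List Bool => (l.length.bodd == r) :=
    (Primrec.beq.comp (Primrec.nat_bodd.comp Primrec.list_length)
      (Primrec.const r)).computableIn
  have hd : ComputableIn O fun l : List Bool => l.length.div2 :=
    (Primrec.nat_div2.comp Primrec.list_length).computableIn
  exact computableIn_comp (g := fun p : Bool × Bool × Bool => cond p.1 p.2.1 p.2.2)
    (Primrec.cond Primrec.fst (Primrec.fst.comp Primrec.snd)
      (Primrec.snd.comp Primrec.snd)).computableIn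
    (computableIn_pair hc (computableIn_pair hs (computableIn_comp hx hd)))

theorem play_against (r : Bool) (s : List Bool → Bool) (x : ℕ → Bool) (n : ℕ) :
    play (against r s x) n = cond (n.bodd == r)
      (s (List.ofFn fun i : Fin n => play (against r s x) i)) (x n.div2) := by
  rw [← position_eq_ofFn, play]
  conv_lhs => rw [against]
  rw [length_position]

/-- The oracle `x` computes both sides' moves; conversely, `x` is read off from the opponent's
moves, at positions `2 * n + (!r).toNat`. -/
theorem turingEquiv_play_against (r : Bool) {s : List Bool → Bool} {x : ℕ → Bool}
    (hs : ComputableIn {oracle x} s) : TuringEquiv (play (against r s x)) x := by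
  refine ⟨turingLE_iff.2 (computableIn_play (computableIn_against r hs (oracle_computableIn x))),
    turingLE_iff.2 ?_⟩
  have hidx : Primrec fun n : ℕ => 2 * n + (!r).toNat :=
    Primrec.nat_add.comp (Primrec.nat_mul.comp (Primrec.const 2) Primrec.id) (Primrec.const _)
  refine (computableIn_comp (oracle_computableIn _) hidx.computableIn).of_eq fun n => ?_
  have hdiv : (2 * n + (!r).toNat).div2 = n := by
    cases r <;> simp [Nat.div2_val]
  beta_reduce
  rw [play_against, hdiv]
  cases r <;> simp

/-- Martin's cone theorem: a determined degree-invariant set or its complement contains a cone. -/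
theorem exists_cone_subset_or_compl {A : Set (ℕ → Bool)} (hA : Determined A)
    (hinv : ∀ x y, TuringEquiv x y → x ∈ A → y ∈ A) :
    ∃ b, (∀ x ∈ cone b, x ∈ A) ∨ ∀ x ∈ cone b, x ∉ A := by
  rcases hA with ⟨s, hs⟩ | ⟨s, hs⟩
  · obtain ⟨b, hb⟩ := exists_computableIn_oracle s
    refine ⟨b, Or.inl fun x hx => ?_⟩
    refine hinv _ x (turingEquiv_play_against false (ComputableIn.of_turingLE hb hx)) (hs _ ?_)
    intro n
    rw [play_against]
    simp
  · obtain ⟨b, hb⟩ := exists_computableIn_oracle s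
    refine ⟨b, Or.inr fun x hx hxA => ?_⟩
    have he := turingEquiv_play_against true (ComputableIn.of_turingLE hb hx)
    refine hs (play (against true s x)) ?_ (hinv x _ ⟨he.2, he.1⟩ hxA)
    intro n
    rw [play_against]
    simp

end Games

/-! ### Finite traces and the PAC guarantee -/

section Traces

/-- Some hypothesis in `H` extends the finite string `s`. -/
def Realizes (H : Set (ℕ → Bool)) (s : Σ n : ℕ, Fin n → Bool) : Prop :=
  ∃ f ∈ H, ∀ i : Fin s.1, f i = s.2 i

theorem analyticSet_realizes {H : (ℕ → Bool) → Set (ℕ → Bool)} (hH : BorelFamily H)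
    (s : Σ n : ℕ, Fin n → Bool) : AnalyticSet {x | Realizes (H x) s} := by
  have hC : IsClosed {p : (ℕ → Bool) × (ℕ → Bool) | ∀ i : Fin s.1, p.2 i = s.2 i} := by
    simp only [Set.ofPred_forall]
    exact isClosed_iInter fun i => isClosed_eq (by fun_prop) continuous_const
  have hG : MeasurableSet {p : (ℕ → Bool) × (ℕ → Bool) | p.2 ∈ H p.1} := by
    -- The Borel σ-algebra of the product is the product σ-algebra.
    rw [BorelFamily, ← BorelSpace.measurable_eq] at hH
    exact hH
  have : PolishSpace Bool := inferInstance
  have : PolishSpace (ℕ → Bool) := inferInstance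
  have : PolishSpace ((ℕ → Bool) × (ℕ → Bool)) := inferInstance
  have hGC := (hG.inter hC.measurableSet).analyticSet
  convert hGC.image_of_continuous continuous_fst using 1
  ext x
  simp [Realizes]

/-- On a cone, the finite traces of an invariant Borel family do not depend on the oracle. -/
theorem exists_cone_realizes_iff (hdet : AnalyticDeterminacy)
    {H : (ℕ → Bool) → Set (ℕ → Bool)} (hinv : DegreeInvariant H) (hH : BorelFamily H) :
    ∃ b, ∀ x ∈ cone b, ∀ y ∈ cone b, ∀ s, Realizes (H x) s → Realizes (H y) s := by
  have h (s : Σ n : ℕ, Fin n → Bool) := exists_cone_subset_or_compl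
    (hdet _ (analyticSet_realizes hH s)) fun x y hxy (hx : Realizes (H x) s) =>
      show Realizes (H y) s from hinv x y hxy ▸ hx
  choose c hc using h
  obtain ⟨b, hb⟩ := exists_turingLE_forall c
  refine ⟨b, fun x hx y hy s hs => ?_⟩
  have hx' : x ∈ cone (c s) := TuringLE.trans (hb s) hx
  have hy' : y ∈ cone (c s) := TuringLE.trans (hb s) hy
  rcases hc s with h | h
  · exact h y hy'
  · exact absurd hs (h x hx')

theorem trueError_le_add_tail (D : Measure (ℕ × Bool)) [IsProbabilityMeasure D] {f g : ℕ → Bool}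
    {n : ℕ} (h : ∀ i < n, f i = g i) :
    trueError D f ≤ trueError D g + D.real {p | n ≤ p.1} := by
  refine (measureReal_mono ?_).trans (measureReal_union_le _ _)
  intro p hp
  by_cases hn : n ≤ p.1
  · exact Or.inr hn
  · exact Or.inl (by simpa [h p.1 (not_le.1 hn)] using hp)

theorem tendsto_tail (D : Measure (ℕ × Bool)) [IsProbabilityMeasure D] :
    Filter.Tendsto (fun n : ℕ => D.real {p | n ≤ p.1}) Filter.atTop (nhds 0) := by
  have h := tendsto_measure_iInter_atTop (μ := D) (s := fun n : ℕ => {p : ℕ × Bool | n ≤ p.1})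
    (fun n => (Set.to_countable _).measurableSet.nullMeasurableSet)
    (fun m n hmn p hp => le_trans hmn hp) ⟨0, measure_ne_top _ _⟩
  have h0 : ⋂ n : ℕ, {p : ℕ × Bool | n ≤ p.1} = ∅ := by
    ext p
    simpa using ⟨p.1 + 1, by omega⟩
  rw [h0, measure_empty] at h
  simpa [Measure.real, Function.comp_def] using (ENNReal.tendsto_toReal ENNReal.zero_ne_top).comp h

theorem bddBelow_trueError (D : Measure (ℕ × Bool)) (H : Set (ℕ → Bool)) :
    BddBelow (trueError D '' H) :=
  ⟨0, by rintro _ ⟨f, -, rfl⟩; exact measureReal_nonneg⟩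

/-- Each `f ∈ K` agrees below `n` with some `g ∈ H`, at the cost of a tail that tends to `0`.
Nonemptiness of `K` matters because `sInf ∅ = 0` in `ℝ`. -/
theorem sInf_trueError_le (D : Measure (ℕ × Bool)) [IsProbabilityMeasure D]
    {H K : Set (ℕ → Bool)} (hK : K.Nonempty) (h : ∀ s, Realizes K s → Realizes H s) :
    sInf (trueError D '' H) ≤ sInf (trueError D '' K) := by
  refine le_csInf (hK.image _) ?_
  rintro _ ⟨f, hf, rfl⟩
  refine ge_of_tendsto (by simpa using (tendsto_tail D).const_add (trueError D f))
    (Filter.Eventually.of_forall fun n => ?_)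
  obtain ⟨g, hg, hgf⟩ := h ⟨n, fun i => f i⟩ ⟨f, hf, fun _ => rfl⟩
  exact (csInf_le (bddBelow_trueError D H) ⟨g, hg, rfl⟩).trans
    (trueError_le_add_tail D fun i hi => hgf ⟨i, hi⟩)

/-- The PAC guarantee depends only on the finite traces of the class. -/
theorem PACGuarantee.of_realizes_iff {H K : Set (ℕ → Bool)} {A : Sample → ℕ → Bool}
    {m : ℝ → ℝ → ℕ} (hH : H.Nonempty) (h : ∀ s, Realizes H s → Realizes K s)
    (h' : ∀ s, Realizes K s → Realizes H s) (hA : PACGuarantee H A m) : PACGuarantee K A m := by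
  intro D hD
  have hK : K.Nonempty := by
    obtain ⟨f, hf⟩ := hH
    -- Realizing the empty string means being nonempty.
    obtain ⟨g, hg, -⟩ := h ⟨0, fun i => f i⟩ ⟨f, hf, fun _ => rfl⟩
    exact ⟨g, hg⟩
  rw [(sInf_trueError_le D hH h).antisymm (sInf_trueError_le D hK h')]
  exact hA D hD

end Traces

end ConeLearning

theorem corollary4p7
    (hdet : ConeLearning.AnalyticDeterminacy)
    (H : (ℕ → Bool) → Set (ℕ → Bool))
    (hinv : ConeLearning.DegreeInvariant H)
    (hBorel : ConeLearning.BorelFamily H)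
    (hPAC : ∃ b : ℕ → Bool, ∀ x ∈ ConeLearning.cone b, ConeLearning.PACLearnable (H x)) :
    ∃ b : ℕ → Bool, ∀ x ∈ ConeLearning.cone b, ConeLearning.ImproperlySCPAC x (H x) := by
  open ConeLearning in
  obtain ⟨b₀, hb₀⟩ := hPAC
  obtain ⟨b₁, hb₁⟩ := exists_cone_realizes_iff hdet hinv hBorel
  obtain ⟨z, hz⟩ := exists_turingLE_forall ![b₀, b₁]
  obtain ⟨A, m, hAH, hA⟩ := hb₀ z (hz 0)
  obtain ⟨a, ha⟩ := exists_computableIn_oracle fun p : Sample × ℕ => A p.1 p.2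
  -- Only the values of `m` at fractions need coding, and these are countably many.
  obtain ⟨c, hc⟩ := exists_computableIn_oracle_nat fun p : (ℕ × ℕ) × ℕ × ℕ =>
    m ((p.1.1 : ℝ) / p.1.2) ((p.2.1 : ℝ) / p.2.2)
  obtain ⟨b, hb⟩ := exists_turingLE_forall ![z, a, c]
  refine ⟨b, fun x hx => ?_⟩
  have hzx : TuringLE z x := TuringLE.trans (hb 0) hx
  have hx₁ : x ∈ cone b₁ := TuringLE.trans (hz 1) hzx
  refine ⟨hb₀ x (TuringLE.trans (hz 0) hzx), A, m,
    ComputableIn.of_turingLE ha (TuringLE.trans (hb 1) hx),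
    ComputableIn.of_turingLE hc (TuringLE.trans (hb 2) hx), ?_⟩
  exact PACGuarantee.of_realizes_iff ⟨A [], hAH []⟩ (hb₁ z (hz 1) x hx₁) (hb₁ x hx₁ z (hz 1)) hA
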